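/- **Proposition 4.3.** All C*-algebras are complex and nonzero, and are not assumed unital. Formulas of the language of C*-algebras are built from the norms $\|t(x_1,\dots,x_n)\|$ of $*$-polynomials $t$ without constant term with complex coefficients, by combining finitely many formulas through a continuous function $\mathbb{R}^k\to\mathbb{R}$, and by taking suprema and infima of a variable over the closed unit ball; a sentence is a formula with no free variables, and $\varphi^{\mathcal A}\in\mathbb{R}$ denotes the value of the sentence $\varphi$ in $\mathcal A$. A C*-algebra $\mathcal A$ is *pseudocompact* if $\varphi^{\mathcal A}=0$ for every sentence $\varphi$ such that $\varphi^{\mathcal F}=0$ for all finite-dimensional C*-algebras $\mathcal F$. Let $\mathcal A$ be a pseudocompact C*-algebra. Then: 1. $\mathcal A$ is unital; 2. $\mathcal A$ has real rank zero: the self-adjoint elements with finite spectrum are dense in the self-adjoint elements of $\mathcal A$; 3. $\mathcal A$ has stable rank one: the invertible elements are dense in $\mathcal A$; 4. $\mathcal A$ is stably finite: for every $n\in\mathbb{N}$ and $v\in M_n(\mathcal A)$, if $v^*v=1$ then $vv^*=1$; 5. $\mathcal A$ has a tracial state: there is a positive linear functional $\tau:\mathcal A\to\mathbb{C}$ with $\tau(1)=1$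 and $\tau(ab)=\tau(ba)$ for all $a,b\in\mathcal A$. -/

import Mathlib

/-! ### Continuous logic for C*-algebras

The language has the norm, addition, multiplication, multiplication by complex scalars, the adjoint
and the constant zero.  C*-algebras are not assumed unital, so there is no symbol for the identity. -/

namespace CStarLogic

/-- `*`-polynomials (without constant term) over `ℂ` in the variables `x₀, …, xₙ₋₁`. -/
inductive Term (n : ℕ) : Type
  | var (i : Fin n) : Term n
  | zero : Term n
  | add (s t : Term n) : Term n
  | mul (s t : Term n) : Term n
  | smul (c : ℂ) (t : Term n) : Term n
  | adj (t : Term n) : Term n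

/-- Formulas whose free variables are among `x₀, …, xₙ₋₁`: norms of `*`-polynomials, finite
combinations through continuous functions, and suprema and infima over the closed unit ball. The
two quantifiers bind the last variable `xₙ` of a formula in `n + 1` variables. -/
inductive Formula : ℕ → Type
  | norm {n : ℕ} (t : Term n) : Formula n
  | conn {n k : ℕ} (f : C(Fin k → ℝ, ℝ)) (φ : Fin k → Formula n) : Formula n
  | sup {n : ℕ} (φ : Formula (n + 1)) : Formula n
  | inf {n : ℕ} (φ : Formula (n + 1)) : Formula n

/-- A sentence is a formula with no free variables. -/
abbrev Sentence : Type := Formula 0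

section Semantics

variable {A : Type*} [NonUnitalCStarAlgebra A]

/-- The value of a `*`-polynomial at a tuple of elements of `A`. -/
def Term.eval {n : ℕ} (v : Fin n → A) : Term n → A
  | .var i => v i
  | .zero => 0
  | .add s t => s.eval v + t.eval v
  | .mul s t => s.eval v * t.eval v
  | .smul c t => c • t.eval v
  | .adj t => star (t.eval v)

/-- The value of a formula at a tuple of elements of `A`. In a sentence all variables range over the
closed unit ball, on which every formula is bounded, so its suprema and infima are genuine ones. -/
noncomputable def Formula.eval : {n : ℕ} → Formula n → (Fin n → A) → ℝ
  | _, .norm t, v => ‖t.eval v‖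
  | _, .conn f φ, v => f fun i => (φ i).eval v
  | _, .sup φ, v => ⨆ x : Metric.closedBall (0 : A) 1, φ.eval (Fin.snoc v (x : A))
  | _, .inf φ, v => ⨅ x : Metric.closedBall (0 : A) 1, φ.eval (Fin.snoc v (x : A))

end Semantics

/-- The value of a sentence in a C*-algebra. -/
noncomputable def Sentence.val (φ : Sentence) (A : Type*) [NonUnitalCStarAlgebra A] : ℝ :=
  Formula.eval φ (Fin.elim0 : Fin 0 → A)

end CStarLogic

/-- A C*-algebra `A` is pseudocompact if every sentence that evaluates to zero in all (nonzero)
finite-dimensional C*-algebras evaluates to zero in `A`. -/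
def IsPseudocompactCStar.{u} (A : Type u) [NonUnitalCStarAlgebra A] : Prop :=
  ∀ φ : CStarLogic.Sentence,
    (∀ (F : Type u) [NonUnitalCStarAlgebra F] [FiniteDimensional ℂ F] [Nontrivial F],
      φ.val F = 0) →
    φ.val A = 0

/-! ### Unital C*-algebras -/

/-- `A` has a (two-sided) multiplicative identity. -/
def HasIdentity (A : Type*) [Mul A] : Prop :=
  ∃ e : A, ∀ x : A, e * x = x ∧ x * e = x

/-- A C*-algebra with an identity, as a unital C*-algebra. All operations, the norm and the adjoint
are the given ones, see `HasIdentity.cstarAlgebra_toNonUnital`. -/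
noncomputable abbrev HasIdentity.cstarAlgebra {A : Type*} [inst : NonUnitalCStarAlgebra A]
    (h : HasIdentity A) : CStarAlgebra A :=
  letI ring : NormedRing A :=
    { inst.toNonUnitalNormedRing with
      one := h.choose
      one_mul := fun x => (h.choose_spec x).1
      mul_one := fun x => (h.choose_spec x).2 }
  letI alg : Algebra ℂ A := Algebra.ofModule
    (fun c x y => smul_mul_assoc c x y) (fun c x y => mul_smul_comm c x y)
  { ring, inst with
    toAlgebra := alg
    norm_smul_le := fun c x => norm_smul_le c x }

theorem HasIdentity.cstarAlgebra_toNonUnital {A : Type*} [inst : NonUnitalCStarAlgebra A]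
    (h : HasIdentity A) :
    @CStarAlgebra.toNonUnitalCStarAlgebra A h.cstarAlgebra = inst := rfl

section Properties

variable (A : Type*) [CStarAlgebra A]

/-- Real rank zero: the self-adjoint elements with finite spectrum are dense in the self-adjoint
elements. -/
def IsRealRankZero : Prop :=
  ∀ a : A, IsSelfAdjoint a → a ∈ closure {b : A | IsSelfAdjoint b ∧ (spectrum ℂ b).Finite}

/-- Stable rank one: the invertible elements are dense. -/
def IsStableRankOne : Prop :=
  Dense {a : A | IsUnit a}

/-- Stable finiteness: in every matrix algebra `Mₙ(A)` every isometry is unitary, that is, the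
identity is not Murray-von Neumann equivalent to a proper subprojection. (The adjoint `star v` of a
matrix is its conjugate transpose.) -/
def IsStablyFiniteCStar : Prop :=
  ∀ (n : ℕ) (v : Matrix (Fin n) (Fin n) A), star v * v = 1 → v * star v = 1

open scoped ComplexOrder in
/-- A tracial state: a positive linear functional `τ` with `τ 1 = 1` and `τ (a * b) = τ (b * a)`. -/
structure TracialState where
  toLinearMap : A →ₗ[ℂ] ℂ
  nonneg : ∀ a : A, 0 ≤ toLinearMap (star a * a)
  map_one : toLinearMap 1 = 1
  tracial : ∀ a b : A, toLinearMap (a * b) = toLinearMap (b * a)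

end Properties

/-! Upper bounds `φ ≤ r` on sentences pass from the nonzero finite-dimensional algebras to A
(`IsPseudocompactCStar.val_le`). Each transferred property therefore has to come from a bound that
is uniform over these algebras. An infimum yields only approximate witnesses, so a perturbation
argument must recover the exact property in A.

Identity: elements of the ball that act almost as an identity on the whole ball form a Cauchy
sequence. Since the language has no constant 1, later sentences express `t = 1` by the action of `t`
on the ball (`Formula.identityDefect`).

Stable rank one: invertibles are dense in finite dimension because spectra are finite. Invertibility
is encoded by an approximate polar decomposition (`exists_approx_polar`): in A the almost unitary
factor is invertible, and the positive factor becomes so after a small shift. Stable finiteness then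
follows without further logic: Schur complements carry density to matrices, and an isometry close to
an invertible is invertible.

Real rank zero: the number of spectral values is not bounded uniformly, so spectra are first rounded
to the grid of multiples of 1/n, a condition given by one polynomial equation
(`exists_approx_grid`). In A the polynomial is merely small, but this keeps the spectrum off the
jumps of the rounding function, which can then be applied by continuous functional calculus.

Tracial state: the normalized trace is contractive, so sums of commutators have distance at least 1
from the identity, and this transfers for every number of summands. Hahn-Banach gives a contractive
unital functional that kills commutators, and such a functional is positive. -/

open Filter Topology

namespace CStarLogic

/-! ### Building terms and formulas -/

section Constructions

/-- The last variable. -/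
abbrev Term.last (n : ℕ) : Term (n + 1) := .var (Fin.last n)

/-- Regard a term as a term with one more variable. -/
def Term.weaken {n : ℕ} : Term n → Term (n + 1)
  | .var i => .var i.castSucc
  | .zero => .zero
  | .add s t => .add s.weaken t.weaken
  | .mul s t => .mul s.weaken t.weaken
  | .smul c t => .smul c t.weaken
  | .adj t => .adj t.weaken

/-- The difference of two terms. -/
abbrev Term.sub {n : ℕ} (s t : Term n) : Term n := .add s (.smul (-1) t)

/-- The self-adjoint part of a term. -/
noncomputable abbrev Term.re {n : ℕ} (t : Term n) : Term n := .smul (1 / 2) (.add t (.adj t))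

/-- The pointwise maximum of two formulas. -/
def Formula.max {n : ℕ} (φ ψ : Formula n) : Formula n :=
  .conn ⟨fun p : Fin 2 → ℝ => Max.max (p 0) (p 1), by fun_prop⟩ ![φ, ψ]

/-- The formula `c * φ + r`. -/
def Formula.affine {n : ℕ} (c r : ℝ) (φ : Formula n) : Formula n :=
  .conn ⟨fun p : Fin 1 → ℝ => c * p 0 + r, by fun_prop⟩ ![φ]

/-- The positive part of `φ - r`. -/
def Formula.truncSub {n : ℕ} (r : ℝ) (φ : Formula n) : Formula n :=
  .conn ⟨fun p : Fin 1 → ℝ => Max.max (p 0 - r) 0, by fun_prop⟩ ![φ]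

/-- How far a term is from being a two-sided identity on the unit ball. -/
def Formula.identityDefect {n : ℕ} (t : Term n) : Formula n :=
  .sup (.max (.norm (.sub (.mul t.weaken (.last n)) (.last n)))
    (.norm (.sub (.mul (.last n) t.weaken) (.last n))))

/-- Quantify the last `k` variables by suprema. -/
def Formula.supLast {n : ℕ} : (k : ℕ) → Formula (n + k) → Formula n
  | 0, φ => φ
  | k + 1, φ => Formula.supLast k (Formula.sup φ)

end Constructions

/-! ### Values of formulas on the unit ball -/

section Semantics

variable {A : Type*} [NonUnitalCStarAlgebra A] {n : ℕ}

@[simp]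
theorem Term.eval_weaken (t : Term n) (v : Fin n → A) (x : A) :
    t.weaken.eval (Fin.snoc v x : Fin (n + 1) → A) = t.eval v := by
  induction t <;> simp_all [Term.weaken, Term.eval]

@[simp]
theorem Term.eval_last (v : Fin n → A) (x : A) :
    (Term.last n).eval (Fin.snoc v x : Fin (n + 1) → A) = x := by
  simp [Term.eval]

@[simp]
theorem Term.eval_sub (s t : Term n) (v : Fin n → A) :
    (s.sub t).eval v = s.eval v - t.eval v := by
  simp [Term.eval, sub_eq_add_neg]

theorem Term.eval_re (t : Term n) (v : Fin n → A) :
    t.re.eval v = (1 / 2 : ℂ) • (t.eval v + star (t.eval v)) := rfl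

/-- A tuple of elements of the unit ball. -/
def InBall (v : Fin n → A) : Prop := ∀ i, ‖v i‖ ≤ 1

theorem InBall.snoc {v : Fin n → A} (hv : InBall v) {x : A} (hx : ‖x‖ ≤ 1) :
    InBall (Fin.snoc v x : Fin (n + 1) → A) := by
  intro i
  refine Fin.lastCases ?_ (fun j => ?_) i
  · simpa using hx
  · simpa using hv j

theorem inBall_elim0 : InBall (Fin.elim0 : Fin 0 → A) := fun i => i.elim0

theorem Term.exists_norm_eval_le (t : Term n) :
    ∃ C, ∀ v : Fin n → A, InBall v → ‖t.eval v‖ ≤ C := by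
  induction t with
  | var i => exact ⟨1, fun v hv => hv i⟩
  | zero => exact ⟨0, fun v _ => by simp [Term.eval]⟩
  | add s t hs ht =>
    obtain ⟨C, hC⟩ := hs
    obtain ⟨D, hD⟩ := ht
    exact ⟨C + D, fun v hv => (norm_add_le _ _).trans (add_le_add (hC v hv) (hD v hv))⟩
  | mul s t hs ht =>
    obtain ⟨C, hC⟩ := hs
    obtain ⟨D, hD⟩ := ht
    exact ⟨C * D, fun v hv => (norm_mul_le _ _).trans
      (mul_le_mul (hC v hv) (hD v hv) (norm_nonneg _) ((norm_nonneg _).trans (hC v hv)))⟩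
  | smul c t ht =>
    obtain ⟨C, hC⟩ := ht
    exact ⟨‖c‖ * C, fun v hv => (norm_smul_le _ _).trans
      (mul_le_mul_of_nonneg_left (hC v hv) (norm_nonneg _))⟩
  | adj t ht =>
    obtain ⟨C, hC⟩ := ht
    exact ⟨C, fun v hv => by simpa [Term.eval] using hC v hv⟩

instance : Nonempty (Metric.closedBall (0 : A) 1) := ⟨⟨0, by simp⟩⟩

/-- Real suprema and infima carry information only for bounded families; this makes the two
quantifier criteria below valid. A connective is bounded because it is continuous on a compact box.
-/
theorem Formula.exists_abs_eval_le (φ : Formula n) :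
    ∃ C, ∀ v : Fin n → A, InBall v → |φ.eval v| ≤ C := by
  induction φ with
  | norm t =>
    obtain ⟨C, hC⟩ := t.exists_norm_eval_le (A := A)
    exact ⟨C, fun v hv => by simpa [Formula.eval] using hC v hv⟩
  | conn f φ ih =>
    choose C hC using ih
    have hK : IsCompact (Set.pi Set.univ fun i => Set.Icc (-C i) (C i)) :=
      isCompact_univ_pi fun i => isCompact_Icc
    obtain ⟨D, hD⟩ := hK.exists_bound_of_continuousOn f.continuous.continuousOn
    exact ⟨D, fun v hv => hD _ fun i _ => abs_le.1 (hC i v hv)⟩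
  | sup φ ih =>
    obtain ⟨C, hC⟩ := ih
    refine ⟨C, fun v hv => ?_⟩
    have key : ∀ x : Metric.closedBall (0 : A) 1, |φ.eval (Fin.snoc v (x : A))| ≤ C :=
      fun x => hC _ (hv.snoc (mem_closedBall_zero_iff.1 x.2))
    have hb : BddAbove (Set.range fun x : Metric.closedBall (0 : A) 1 =>
        φ.eval (Fin.snoc v (x : A))) := ⟨C, by rintro _ ⟨x, rfl⟩; exact (abs_le.1 (key x)).2⟩
    refine abs_le.2 ⟨?_, ciSup_le fun x => (abs_le.1 (key x)).2⟩
    exact (abs_le.1 (key (Classical.arbitrary _))).1.trans (le_ciSup hb _)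
  | inf φ ih =>
    obtain ⟨C, hC⟩ := ih
    refine ⟨C, fun v hv => ?_⟩
    have key : ∀ x : Metric.closedBall (0 : A) 1, |φ.eval (Fin.snoc v (x : A))| ≤ C :=
      fun x => hC _ (hv.snoc (mem_closedBall_zero_iff.1 x.2))
    have hb : BddBelow (Set.range fun x : Metric.closedBall (0 : A) 1 =>
        φ.eval (Fin.snoc v (x : A))) := ⟨-C, by rintro _ ⟨x, rfl⟩; exact (abs_le.1 (key x)).1⟩
    refine abs_le.2 ⟨le_ciInf fun x => (abs_le.1 (key x)).1, ?_⟩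
    exact (ciInf_le hb _).trans (abs_le.1 (key (Classical.arbitrary _))).2

theorem Formula.eval_sup_le_iff {φ : Formula (n + 1)} {v : Fin n → A} (hv : InBall v) {r : ℝ} :
    φ.sup.eval v ≤ r ↔ ∀ x : A, ‖x‖ ≤ 1 → φ.eval (Fin.snoc v x) ≤ r := by
  obtain ⟨C, hC⟩ := φ.exists_abs_eval_le (A := A)
  have hb : BddAbove (Set.range fun x : Metric.closedBall (0 : A) 1 =>
      φ.eval (Fin.snoc v (x : A))) := ⟨C, by
    rintro _ ⟨x, rfl⟩; exact (abs_le.1 (hC _ (hv.snoc (mem_closedBall_zero_iff.1 x.2)))).2⟩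
  refine (ciSup_le_iff hb).trans ⟨fun h x hx => h ⟨x, by simpa using hx⟩, fun h x => ?_⟩
  exact h x (mem_closedBall_zero_iff.1 x.2)

theorem Formula.eval_inf_le_iff {φ : Formula (n + 1)} {v : Fin n → A} (hv : InBall v) {r : ℝ} :
    φ.inf.eval v ≤ r ↔ ∀ ε > 0, ∃ x : A, ‖x‖ ≤ 1 ∧ φ.eval (Fin.snoc v x) ≤ r + ε := by
  obtain ⟨C, hC⟩ := φ.exists_abs_eval_le (A := A)
  have hb : BddBelow (Set.range fun x : Metric.closedBall (0 : A) 1 =>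
      φ.eval (Fin.snoc v (x : A))) := ⟨-C, by
    rintro _ ⟨x, rfl⟩; exact (abs_le.1 (hC _ (hv.snoc (mem_closedBall_zero_iff.1 x.2)))).1⟩
  constructor
  · intro h ε hε
    obtain ⟨x, hx⟩ := exists_lt_of_ciInf_lt (lt_of_le_of_lt h (lt_add_of_pos_right r hε))
    exact ⟨x, mem_closedBall_zero_iff.1 x.2, hx.le⟩
  · intro h
    refine le_of_forall_pos_le_add fun ε hε => ?_
    obtain ⟨x, hx, hx'⟩ := h ε hε
    exact (ciInf_le hb ⟨x, by simpa using hx⟩).trans hx'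

@[simp]
theorem Formula.eval_max (φ ψ : Formula n) (v : Fin n → A) :
    (φ.max ψ).eval v = Max.max (φ.eval v) (ψ.eval v) := by
  simp [Formula.max, Formula.eval]

@[simp]
theorem Formula.eval_affine (c r : ℝ) (φ : Formula n) (v : Fin n → A) :
    (φ.affine c r).eval v = c * φ.eval v + r := by
  simp [Formula.affine, Formula.eval]

@[simp]
theorem Formula.eval_truncSub (r : ℝ) (φ : Formula n) (v : Fin n → A) :
    (φ.truncSub r).eval v = Max.max (φ.eval v - r) 0 := by
  simp [Formula.truncSub, Formula.eval]

theorem Formula.eval_identityDefect_le_iff {t : Term n} {v : Fin n → A} (hv : InBall v) {r : ℝ} :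
    (Formula.identityDefect t).eval v ≤ r ↔
      ∀ x : A, ‖x‖ ≤ 1 → ‖t.eval v * x - x‖ ≤ r ∧ ‖x * t.eval v - x‖ ≤ r := by
  simp only [identityDefect, eval_sup_le_iff hv, eval_max, max_le_iff]
  refine forall₂_congr fun x _ => ?_
  simp only [Formula.eval, Term.eval_sub]
  simp only [Term.eval, Term.eval_weaken, Fin.snoc_last]

theorem Formula.eval_supLast_le_iff {k : ℕ} {φ : Formula (n + k)} {v : Fin n → A} (hv : InBall v)
    {r : ℝ} : (φ.supLast k).eval v ≤ r ↔
      ∀ w : Fin k → A, InBall w → φ.eval (Fin.append v w) ≤ r := by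
  induction k with
  | zero =>
    simp only [supLast]
    have : ∀ w : Fin 0 → A, Fin.append v w = v := fun w => by
      rw [Subsingleton.elim w Fin.elim0, Fin.append_elim0]; rfl
    simp only [this]
    exact ⟨fun h _ _ => h, fun h => h Fin.elim0 inBall_elim0⟩
  | succ k ih =>
    rw [supLast, ih]
    constructor
    · intro h w hw
      have h1 := h (Fin.init w) (fun i => hw i.castSucc)
      rw [eval_sup_le_iff] at h1
      · have := h1 (w (Fin.last k)) (hw _)
        rwa [← Fin.append_snoc, Fin.snoc_init_self] at this
      · intro i
        refine Fin.addCases (fun i => ?_) (fun i => ?_) i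
        · simpa using hv i
        · simpa [Fin.init] using hw i.castSucc
    · intro h w hw
      rw [eval_sup_le_iff]
      · intro x hx
        rw [← Fin.append_snoc]
        exact h _ (hw.snoc hx)
      · intro i
        refine Fin.addCases (fun i => ?_) (fun i => ?_) i
        · simpa using hv i
        · simpa using hw i

end Semantics

end CStarLogic

/-! ### Transfer of bounds, and the identity -/

/-- Upper bounds of sentences pass from nonzero finite-dimensional C*-algebras to pseudocompact
ones. -/
theorem IsPseudocompactCStar.val_le.{u} {A : Type u} [NonUnitalCStarAlgebra A]
    (hA : IsPseudocompactCStar A) {φ : CStarLogic.Sentence} {r : ℝ}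
    (h : ∀ (F : Type u) [NonUnitalCStarAlgebra F] [FiniteDimensional ℂ F] [Nontrivial F],
      φ.val F ≤ r) : φ.val A ≤ r := by
  -- The positive part of `φ - r` vanishes exactly when `φ ≤ r`.
  have := hA (CStarLogic.Formula.truncSub r φ) fun F _ _ _ => by
    simpa [CStarLogic.Sentence.val] using h F
  simpa [CStarLogic.Sentence.val] using this

open CStarLogic

/-- A finite-dimensional C*-algebra has an identity. -/
theorem HasIdentity.of_finiteDimensional (F : Type*) [NonUnitalCStarAlgebra F]
    [FiniteDimensional ℂ F] : HasIdentity F := by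
  let _ := CStarAlgebra.spectralOrder F
  have := CStarAlgebra.spectralOrderedRing F
  have hu := CStarAlgebra.increasingApproximateUnit F
  have : ProperSpace F := FiniteDimensional.proper ℂ F
  have hc : IsCompact (Metric.closedBall (0 : F) 1) := isCompact_closedBall 0 1
  -- By compactness the approximate unit clusters at some `e`. Then `e * x` is a cluster point of a
  -- filter converging to `x`, hence equals `x`.
  obtain ⟨e, -, he⟩ := hc.exists_clusterPt (f := CStarAlgebra.approximateUnit F)
    (by simpa using hu.closedBall_mem)
  refine ⟨e, fun x => ⟨?_, ?_⟩⟩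
  · have h1 := hu.tendsto_mul_right x
    have h2 : ClusterPt (e * x) (map (fun y => y * x) (CStarAlgebra.approximateUnit F)) :=
      he.map (by fun_prop : Continuous fun y : F => y * x).continuousAt tendsto_map
    exact (t2_iff_nhds.1 inferInstance (h2.mono h1))
  · have h1 := hu.tendsto_mul_left x
    have h2 : ClusterPt (x * e) (map (fun y => x * y) (CStarAlgebra.approximateUnit F)) :=
      he.map (by fun_prop : Continuous fun y : F => x * y).continuousAt tendsto_map
    exact (t2_iff_nhds.1 inferInstance (h2.mono h1))

theorem CStarAlgebra.norm_one_le (A : Type*) [CStarAlgebra A] : ‖(1 : A)‖ ≤ 1 := by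
  nontriviality A
  exact CStarRing.norm_one.le

/-- Upper bounds of sentences pass from nonzero finite-dimensional unital C*-algebras to
pseudocompact ones. -/
theorem IsPseudocompactCStar.val_le_of_unital.{u} {A : Type u} [NonUnitalCStarAlgebra A]
    (hA : IsPseudocompactCStar A) {φ : Sentence} {r : ℝ}
    (h : ∀ (F : Type u) [CStarAlgebra F] [FiniteDimensional ℂ F] [Nontrivial F],
      φ.val F ≤ r) : φ.val A ≤ r := by
  refine hA.val_le fun F _ hF _ => ?_
  have hi := HasIdentity.of_finiteDimensional F
  let _ := hi.cstarAlgebra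
  have : FiniteDimensional ℂ F := hF
  exact h F

/-- A pseudocompact C*-algebra has approximate identities on the whole unit ball. -/
theorem IsPseudocompactCStar.exists_approx_identity {A : Type*} [NonUnitalCStarAlgebra A]
    (hA : IsPseudocompactCStar A) {ε : ℝ} (hε : 0 < ε) :
    ∃ e : A, ‖e‖ ≤ 1 ∧ ∀ x : A, ‖x‖ ≤ 1 → ‖e * x - x‖ ≤ ε ∧ ‖x * e - x‖ ≤ ε := by
  have h : Sentence.val (.inf (Formula.identityDefect (Term.last 0))) A ≤ 0 := by
    refine hA.val_le_of_unital fun F _ _ _ => ?_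
    rw [Sentence.val, Formula.eval_inf_le_iff inBall_elim0]
    intro ε hε
    refine ⟨1, CStarAlgebra.norm_one_le F, ?_⟩
    rw [Formula.eval_identityDefect_le_iff (inBall_elim0.snoc (CStarAlgebra.norm_one_le F))]
    intro x _
    simpa using hε.le
  rw [Sentence.val, Formula.eval_inf_le_iff inBall_elim0] at h
  obtain ⟨e, he, h⟩ := h ε hε
  rw [Formula.eval_identityDefect_le_iff (inBall_elim0.snoc he)] at h
  exact ⟨e, he, by simpa using h⟩

/-- If `e` and `f` are approximate identities in the ball, then `e * f` is close to both, so they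
are close to each other. Hence approximate identities with errors tending to 0 converge, and the
limit is an identity. -/
theorem IsPseudocompactCStar.hasIdentity {A : Type*} [NonUnitalCStarAlgebra A]
    (hA : IsPseudocompactCStar A) : HasIdentity A := by
  obtain ⟨u, -, hu0, hu⟩ := exists_seq_strictAnti_tendsto (0 : ℝ)
  choose e he h using fun n => hA.exists_approx_identity (hu0 n)
  have hcau : CauchySeq e := by
    rw [Metric.cauchySeq_iff']
    intro ε hε
    obtain ⟨N, hN⟩ := (hu.eventually (gt_mem_nhds (half_pos hε))).exists_forall_of_atTop
    refine ⟨N, fun n hn => ?_⟩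
    have h1 := (h N (e n) (he n)).1
    have h2 := (h n (e N) (he N)).2
    rw [dist_eq_norm]
    calc ‖e n - e N‖ = ‖(e N * e n - e N) - (e N * e n - e n)‖ := by congr 1; abel
      _ ≤ ‖e N * e n - e N‖ + ‖e N * e n - e n‖ := norm_sub_le _ _
      _ < ε := by linarith [hN n hn, hN N le_rfl]
  obtain ⟨f, hf⟩ := cauchySeq_tendsto_of_complete hcau
  have key : ∀ x : A, ‖x‖ ≤ 1 → f * x = x ∧ x * f = x := fun x hx => by
    constructor
    · refine tendsto_nhds_unique (hf.mul_const x) ?_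
      rw [tendsto_iff_norm_sub_tendsto_zero]
      exact squeeze_zero (fun _ => norm_nonneg _) (fun n => (h n x hx).1) hu
    · refine tendsto_nhds_unique (hf.const_mul x) ?_
      rw [tendsto_iff_norm_sub_tendsto_zero]
      exact squeeze_zero (fun _ => norm_nonneg _) (fun n => (h n x hx).2) hu
  refine ⟨f, fun x => ?_⟩
  have hc : ((‖x‖ + 1 : ℝ) : ℂ) ≠ 0 := by
    exact_mod_cast (by positivity : (‖x‖ + 1 : ℝ) ≠ 0)
  have hn : ‖((‖x‖ + 1 : ℝ) : ℂ)⁻¹ • x‖ ≤ 1 := by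
    rw [norm_smul, norm_inv, Complex.norm_real, Real.norm_of_nonneg (by positivity),
      inv_mul_le_one₀ (by positivity)]
    linarith
  obtain ⟨h1, h2⟩ := key _ hn
  rw [mul_smul_comm] at h1
  rw [smul_mul_assoc] at h2
  exact ⟨smul_right_injective A (inv_ne_zero hc) h1, smul_right_injective A (inv_ne_zero hc) h2⟩

/-! ### Stable rank one -/

theorem spectrum.finite_of_finiteDimensional {F : Type*} [Ring F] [Algebra ℂ F]
    [FiniteDimensional ℂ F] (a : F) : (spectrum ℂ a).Finite := by
  nontriviality F
  have hint : IsIntegral ℂ a := Algebra.IsIntegral.isIntegral a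
  refine (Polynomial.finite_setOfPred_isRoot (minpoly.ne_zero hint)).subset fun z hz => ?_
  have := spectrum.subset_polynomial_aeval a (minpoly ℂ a) ⟨z, hz, rfl⟩
  simpa using this

/-- Every element of a finite-dimensional algebra is a limit of invertible elements. -/
theorem IsStableRankOne.of_finiteDimensional (F : Type*) [CStarAlgebra F]
    [FiniteDimensional ℂ F] : IsStableRankOne F := by
  intro a
  -- The spectrum is finite, so every small nonzero scalar lies outside it and shifting by that
  -- scalar makes `a` invertible.
  have h : Tendsto (fun z : ℂ => a - algebraMap ℂ F z) (𝓝[≠] 0) (𝓝 a) := by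
    have : Continuous fun z : ℂ => a - algebraMap ℂ F z := by fun_prop
    simpa using (this.tendsto 0).mono_left nhdsWithin_le_nhds
  refine mem_closure_of_tendsto h ?_
  have h1 : ∀ᶠ z in 𝓝[≠] (0 : ℂ), z ∉ spectrum ℂ a \ {0} := by
    refine nhdsWithin_le_nhds (IsOpen.mem_nhds (IsClosed.isOpen_compl (self := ?_)) (by simp))
    exact ((spectrum.finite_of_finiteDimensional a).subset Set.sdiff_subset).isClosed
  filter_upwards [h1, self_mem_nhdsWithin] with z hz hz0
  have : z ∉ spectrum ℂ a := fun h => hz ⟨h, hz0⟩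
  rw [spectrum.notMem_iff] at this
  simpa using this.neg

/-- Polar decomposition of an invertible element, the positive part being written as a square. -/
theorem exists_unitary_mul_star_mul_self {A : Type*} [CStarAlgebra A] {b : A} (hb : IsUnit b)
    (hb1 : ‖b‖ ≤ 1) :
    ∃ u y : A, star u * u = 1 ∧ u * star u = 1 ∧ ‖y‖ ≤ 1 ∧ b = u * (star y * y) := by
  set c : A := star b * b with hc
  have hcs : IsSelfAdjoint c := .star_mul_self b
  have hcu : IsUnit c := hb.star.mul hb
  have hpos : ∀ x ∈ spectrum ℝ c, 0 < x := fun x hx =>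
    lt_of_le_of_ne (spectrum_star_mul_self_nonneg x hx) fun h =>
      spectrum.zero_notMem ℝ hcu (h ▸ hx)
  have hcn : ‖c‖ ≤ 1 := by
    rw [hc, CStarRing.norm_star_mul_self]
    exact mul_le_one₀ hb1 (norm_nonneg _) hb1
  have hcont : ∀ s : ℝ, ContinuousOn (fun x : ℝ => x ^ s) (spectrum ℝ c) := fun s x hx =>
    (Real.continuousAt_rpow_const x s (Or.inl (hpos x hx).ne')).continuousWithinAt
  have hmul : ∀ s t : ℝ, cfc (fun x : ℝ => x ^ s) c * cfc (fun x : ℝ => x ^ t) c =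
      cfc (fun x : ℝ => x ^ (s + t)) c := fun s t => by
    rw [← cfc_mul _ _ c (hcont s) (hcont t)]
    exact cfc_congr fun x hx => (Real.rpow_add (hpos x hx) s t).symm
  have hzero : cfc (fun _ : ℝ => (1 : ℝ)) c = 1 := cfc_const_one ℝ c
  have hmulc : ∀ t : ℝ, c * cfc (fun x : ℝ => x ^ t) c = cfc (fun x : ℝ => x ^ (1 + t)) c :=
    fun t => by
      rw [← hmul]
      simp only [Real.rpow_one]
      rw [cfc_id' ℝ c]
  have hsa : ∀ s : ℝ, star (cfc (fun x : ℝ => x ^ s) c) = cfc (fun x : ℝ => x ^ s) c :=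
    fun s => (cfc_predicate (fun x : ℝ => x ^ s) c : IsSelfAdjoint _)
  -- With `c = star b * b`, the unitary is `b * c^(-1/2)` and the positive part is `c^(1/2) = star y
  -- * y` for `y = c^(1/4)`.
  set p := cfc (fun x : ℝ => x ^ (-(1 / 2) : ℝ)) c with hp
  set y := cfc (fun x : ℝ => x ^ (1 / 4 : ℝ)) c with hy
  have hyy : y * y = cfc (fun x : ℝ => x ^ (1 / 2 : ℝ)) c := by
    rw [hy, hmul]; norm_num
  have hpu : IsUnit p := by
    refine isUnit_iff_exists_and_exists.2 ⟨⟨y * y, ?_⟩, ⟨y * y, ?_⟩⟩ <;>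
    · rw [hyy, hp, hmul]; norm_num [hzero]
  have hu1 : star (b * p) * (b * p) = 1 := by
    rw [star_mul, hsa, mul_assoc, ← mul_assoc (star b), ← hc, hp, hmulc, hmul]
    norm_num [hzero]
  refine ⟨b * p, y, hu1, ?_, ?_, ?_⟩
  · obtain ⟨w, hw⟩ := hb.mul hpu
    rw [← hw] at hu1 ⊢
    rw [left_inv_eq_right_inv hu1 w.mul_inv, w.mul_inv]
  · refine norm_cfc_le zero_le_one fun x hx => ?_
    have h1 : |x| ≤ 1 := by
      have := (spectrum.norm_le_norm_mul_of_mem hx)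
      have h1 := CStarAlgebra.norm_one_le A
      simp only [Real.norm_eq_abs] at this
      nlinarith [norm_nonneg c]
    rw [Real.norm_of_nonneg (Real.rpow_nonneg (hpos x hx).le _)]
    exact Real.rpow_le_one (hpos x hx).le ((le_abs_self x).trans h1) (by norm_num)
  · rw [hy, hsa, ← hy, hyy, mul_assoc, hp, hmul]
    norm_num [hzero]

/-- Density of invertibles in a form the language can express: positivity is witnessed by `star y *
y`, unitarity by identity defects. The factor 2 keeps `y` in the unit ball, since an invertible near
`a` may have norm greater than 1. -/
theorem IsPseudocompactCStar.exists_approx_polar {A : Type*} [CStarAlgebra A]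
    (hA : IsPseudocompactCStar A) {a : A} (ha : ‖a‖ ≤ 1) {ε : ℝ} (hε : 0 < ε) :
    ∃ u y : A, ‖u‖ ≤ 1 ∧ ‖a - (2 : ℂ) • (u * (star y * y))‖ ≤ ε ∧ ‖star u * u - 1‖ ≤ ε ∧
      ‖u * star u - 1‖ ≤ ε := by
  set a' : Term 3 := (Term.last 0).weaken.weaken with ha'
  set u' : Term 3 := (Term.last 1).weaken with hu'
  set y' : Term 3 := Term.last 2 with hy'
  set φ : Formula 3 := .max (.norm (a'.sub (.smul 2 (.mul u' (.mul (.adj y') y')))))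
    (.max (.identityDefect (.mul (.adj u') u')) (.identityDefect (.mul u' (.adj u')))) with hφ
  have hval : ∀ {B : Type _} [CStarAlgebra B] {a u y : B}, ‖a‖ ≤ 1 → ‖u‖ ≤ 1 → ‖y‖ ≤ 1 →
      ∀ r : ℝ, (φ.eval (Fin.snoc (Fin.snoc (Fin.snoc Fin.elim0 a : Fin 1 → B) u : Fin 2 → B) y :
        Fin 3 → B) ≤ r ↔ ‖a - (2 : ℂ) • (u * (star y * y))‖ ≤ r ∧
        (∀ x : B, ‖x‖ ≤ 1 → ‖star u * u * x - x‖ ≤ r ∧ ‖x * (star u * u) - x‖ ≤ r) ∧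
        (∀ x : B, ‖x‖ ≤ 1 → ‖u * star u * x - x‖ ≤ r ∧ ‖x * (u * star u) - x‖ ≤ r)) := by
    intro B _ a u y ha hu hy r
    have hb := ((inBall_elim0.snoc ha).snoc hu).snoc hy
    rw [hφ, Formula.eval_max, Formula.eval_max, max_le_iff, max_le_iff,
      Formula.eval_identityDefect_le_iff hb, Formula.eval_identityDefect_le_iff hb]
    simp only [Formula.eval, Term.eval_sub]
    simp only [ha', hu', hy', Term.eval, Term.eval_weaken, Term.eval_last, Fin.snoc_last]
  have h : Sentence.val (.sup (.inf (.inf φ))) A ≤ 0 := by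
    refine hA.val_le_of_unital fun F _ _ _ => ?_
    rw [Sentence.val, Formula.eval_sup_le_iff inBall_elim0]
    intro a ha
    rw [Formula.eval_inf_le_iff (inBall_elim0.snoc ha)]
    intro ε hε
    -- The bound 1 on the distance ensures `‖b‖ ≤ 2`, so `b / 2` lies in the unit ball.
    obtain ⟨b, hb, hab⟩ := Metric.dense_iff.1 (IsStableRankOne.of_finiteDimensional F) a (min ε 1)
      (by positivity)
    rw [Metric.mem_ball, dist_comm, dist_eq_norm] at hb
    have hb2 : ‖(1 / 2 : ℂ) • b‖ ≤ 1 := by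
      have h1 : ‖b‖ ≤ ‖a‖ + ‖a - b‖ := by
        simpa using norm_sub_le a (a - b)
      have h2 := hb.trans_le (min_le_right _ _)
      rw [norm_smul]
      norm_num
      linarith
    have hbu : IsUnit ((1 / 2 : ℂ) • b) := by
      have := (IsUnit.mk0 (1 / 2 : ℂ) (by norm_num)).map (algebraMap ℂ F) |>.mul hab
      rwa [← Algebra.smul_def] at this
    obtain ⟨u, y, hu1, hu2, hy, huy⟩ := exists_unitary_mul_star_mul_self hbu hb2
    have hu : ‖u‖ ≤ 1 := by
      have : ‖u‖ * ‖u‖ ≤ 1 := by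
        rw [← CStarRing.norm_star_mul_self, hu1]; exact CStarAlgebra.norm_one_le F
      nlinarith [norm_nonneg u]
    refine ⟨u, hu, ?_⟩
    rw [Formula.eval_inf_le_iff ((inBall_elim0.snoc ha).snoc hu)]
    intro δ hδ
    refine ⟨y, hy, ?_⟩
    rw [hval ha hu hy]
    refine ⟨?_, ?_, ?_⟩
    · rw [← huy, smul_smul]
      norm_num
      linarith [hb.trans_le (min_le_left _ _)]
    · intro x _; simp [hu1]; positivity
    · intro x _; simp [hu2]; positivity
  rw [Sentence.val, Formula.eval_sup_le_iff inBall_elim0] at h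
  have h := h a ha
  rw [Formula.eval_inf_le_iff (inBall_elim0.snoc ha)] at h
  obtain ⟨u, hu, h⟩ := h (ε / 2) (half_pos hε)
  rw [Formula.eval_inf_le_iff ((inBall_elim0.snoc ha).snoc hu)] at h
  obtain ⟨y, hy, h⟩ := h (ε / 2) (half_pos hε)
  rw [hval ha hu hy, zero_add, add_halves] at h
  obtain ⟨h1, h2, h3⟩ := h
  refine ⟨u, y, hu, h1, ?_, ?_⟩
  · simpa using (h2 1 (CStarAlgebra.norm_one_le A)).1
  · simpa using (h3 1 (CStarAlgebra.norm_one_le A)).1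

theorem isUnit_of_norm_sub_one_lt {A : Type*} [NormedRing A] [CompleteSpace A] {a : A}
    (h : ‖a - 1‖ < 1) : IsUnit a := by
  have := isUnit_one_sub_of_norm_lt_one (x := 1 - a) (by rwa [norm_sub_rev])
  simpa using this

theorem IsPseudocompactCStar.isStableRankOne {A : Type*} [CStarAlgebra A]
    (hA : IsPseudocompactCStar A) : IsStableRankOne A := by
  have key : ∀ a : A, ‖a‖ ≤ 1 → a ∈ closure {a : A | IsUnit a} := by
    intro a ha
    rw [Metric.mem_closure_iff]
    intro ε hε
    -- Error 1/2 makes `star u * u` and `u * star u` invertible, hence `u`. Shifting the positive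
    -- part by `ε / 8` costs at most `ε / 4`, on top of `ε / 2`.
    obtain ⟨u, y, hu, h1, h2, h3⟩ := hA.exists_approx_polar ha (ε := min (ε / 2) (1 / 2))
      (by positivity)
    have hu1 := isUnit_of_norm_sub_one_lt (h2.trans_lt ((min_le_right _ _).trans_lt (by norm_num)))
    have hu2 := isUnit_of_norm_sub_one_lt (h3.trans_lt ((min_le_right _ _).trans_lt (by norm_num)))
    have huu : IsUnit u := by
      obtain ⟨b, hb⟩ := hu1.exists_left_inv
      obtain ⟨c, hc⟩ := hu2.exists_right_inv
      exact isUnit_iff_exists_and_exists.2 ⟨⟨star u * c, by rw [← mul_assoc, hc]⟩,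
        ⟨b * star u, by rw [mul_assoc, hb]⟩⟩
    have hyu : IsUnit (star y * y + algebraMap ℝ A (ε / 8)) := by
      have : -(ε / 8) ∉ spectrum ℝ (star y * y) := fun h => by
        linarith [spectrum_star_mul_self_nonneg _ h]
      rw [spectrum.notMem_iff] at this
      convert this.neg using 1
      simp
    have h2u : IsUnit (algebraMap ℂ A 2) := (IsUnit.mk0 (2 : ℂ) (by norm_num)).map (algebraMap ℂ A)
    refine ⟨(2 : ℂ) • (u * (star y * y + algebraMap ℝ A (ε / 8))), ?_, ?_⟩
    · rw [Algebra.smul_def]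
      exact h2u.mul (huu.mul hyu)
    · rw [dist_eq_norm]
      have h4 : ‖(2 : ℂ) • (u * algebraMap ℝ A (ε / 8))‖ ≤ ε / 4 := by
        have h5 : ‖algebraMap ℝ A (ε / 8)‖ ≤ ε / 8 := by
          rw [norm_algebraMap, Real.norm_of_nonneg (by positivity)]
          exact mul_le_of_le_one_right (by positivity) (CStarAlgebra.norm_one_le A)
        rw [norm_smul]
        have h6 : ‖u * algebraMap ℝ A (ε / 8)‖ ≤ 1 * (ε / 8) :=
          (norm_mul_le _ _).trans (mul_le_mul hu h5 (norm_nonneg _) zero_le_one)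
        norm_num at h6 ⊢
        linarith
      calc _ = ‖(a - (2 : ℂ) • (u * (star y * y))) - (2 : ℂ) • (u * algebraMap ℝ A (ε / 8))‖ := by
            rw [mul_add, smul_add, sub_add_eq_sub_sub]
        _ ≤ _ := norm_sub_le _ _
        _ < ε := by linarith [h1.trans (min_le_left _ _)]
  intro a
  have hc : ((‖a‖ + 1 : ℝ) : ℂ) ≠ 0 := by
    exact_mod_cast (by positivity : (‖a‖ + 1 : ℝ) ≠ 0)
  have hn : ‖((‖a‖ + 1 : ℝ) : ℂ)⁻¹ • a‖ ≤ 1 := by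
    rw [norm_smul, norm_inv, Complex.norm_real, Real.norm_of_nonneg (by positivity),
      inv_mul_le_one₀ (by positivity)]
    linarith
  have := map_mem_closure (continuous_const_smul ((‖a‖ + 1 : ℝ) : ℂ)) (key _ hn)
    (t := {a : A | IsUnit a}) fun b hb => by
      rw [Algebra.smul_def]
      exact ((IsUnit.mk0 _ hc).map (algebraMap ℂ A)).mul hb
  rwa [smul_inv_smul₀ hc] at this

/-! ### Stable finiteness -/

/-- Block LDU factorization with pivot `a`, whose inverse is `w`. Writing the last corner as `s + c
* w * b` leaves the Schur complement `s` free to be perturbed. -/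
theorem isUnit_fromBlocks_of_schur {R m n : Type*} [Ring R] [Fintype m] [Fintype n]
    [DecidableEq m] [DecidableEq n] {a : Matrix m m R} {b : Matrix m n R} {c : Matrix n m R}
    {s : Matrix n n R} (w : Matrix m m R) (haw : a * w = 1) (hwa : w * a = 1) (hs : IsUnit s) :
    IsUnit (Matrix.fromBlocks a b c (s + c * w * b)) := by
  have hl : IsUnit (Matrix.fromBlocks (1 : Matrix m m R) 0 (c * w) (1 : Matrix n n R)) :=
    isUnit_iff_exists.2 ⟨Matrix.fromBlocks 1 0 (-(c * w)) 1, by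
      simp [Matrix.fromBlocks_multiply, ← Matrix.fromBlocks_one]⟩
  have hr : IsUnit (Matrix.fromBlocks (1 : Matrix m m R) (w * b) 0 (1 : Matrix n n R)) :=
    isUnit_iff_exists.2 ⟨Matrix.fromBlocks 1 (-(w * b)) 0 1, by
      simp [Matrix.fromBlocks_multiply, ← Matrix.fromBlocks_one]⟩
  obtain ⟨t, hst, hts⟩ := isUnit_iff_exists.1 hs
  have hd : IsUnit (Matrix.fromBlocks a 0 0 s) :=
    isUnit_iff_exists.2 ⟨Matrix.fromBlocks w 0 0 t, by
      simp [Matrix.fromBlocks_multiply, ← Matrix.fromBlocks_one, *]⟩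
  convert (hl.mul hd).mul hr using 1
  simp only [Matrix.fromBlocks_multiply, Matrix.one_mul, Matrix.mul_one, Matrix.zero_mul,
    Matrix.mul_zero, add_zero, zero_add, Matrix.fromBlocks_inj, true_and]
  refine ⟨?_, ?_, ?_⟩
  · rw [← Matrix.mul_assoc, haw, Matrix.one_mul]
  · rw [Matrix.mul_assoc, hwa, Matrix.mul_one]
  · rw [Matrix.mul_assoc c w a, hwa, Matrix.mul_one, Matrix.mul_assoc, add_comm]

/-- Density of the invertible elements passes to matrix rings. -/
theorem Matrix.dense_setOf_isUnit {R : Type*} [Ring R] [TopologicalSpace R] [IsTopologicalRing R]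
    (h : Dense {a : R | IsUnit a}) (n : ℕ) : Dense {a : Matrix (Fin n) (Fin n) R | IsUnit a} := by
  induction n with
  | zero =>
    intro a
    exact subset_closure (by rw [Set.mem_ofPred_eq, Subsingleton.elim a 1]; exact isUnit_one)
  | succ n ih =>
    let e : Fin 1 ⊕ Fin n ≃ Fin (n + 1) := finSumFinEquiv.trans (finCongr (add_comm 1 n))
    intro v
    set v' := v.submatrix e e with hv'
    set K : Set (Matrix (Fin 1 ⊕ Fin n) (Fin 1 ⊕ Fin n) R) := {a | IsUnit a} with hK
    have hcl : v' ∈ closure K := by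
      set a := v'.toBlocks₁₁ 0 0 with ha
      set b := v'.toBlocks₁₂
      set c := v'.toBlocks₂₁
      set d := v'.toBlocks₂₂
      -- Two successive approximations: for an invertible corner `x` the Schur complement is
      -- perturbed, by induction; afterwards the corner itself is approximated by invertibles.
      have hdiag : ∀ x : R, IsUnit x →
          Matrix.fromBlocks (Matrix.of fun _ _ : Fin 1 => x) b c d ∈ closure K := by
        intro x hx
        obtain ⟨y, hxy, hyx⟩ := isUnit_iff_exists.1 hx
        set w : Matrix (Fin 1) (Fin 1) R := Matrix.of fun _ _ => y
        have h1 : (Matrix.of fun _ _ : Fin 1 => x) * w = 1 := by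
          ext i j; fin_cases i; fin_cases j; simp [Matrix.mul_apply, w, hxy]
        have h2 : w * (Matrix.of fun _ _ : Fin 1 => x) = 1 := by
          ext i j; fin_cases i; fin_cases j; simp [Matrix.mul_apply, w, hyx]
        have hc : Continuous fun s : Matrix (Fin n) (Fin n) R =>
            Matrix.fromBlocks (Matrix.of fun _ _ : Fin 1 => x) b c (s + c * w * b) := by
          fun_prop
        have := map_mem_closure hc (ih (d - c * w * b)) (t := K) fun s hs =>
          isUnit_fromBlocks_of_schur w h1 h2 hs
        simpa using this
      have hc : Continuous fun x : R =>
          Matrix.fromBlocks (Matrix.of fun _ _ : Fin 1 => x) b c d := by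
        fun_prop
      have := map_mem_closure hc (h a) (t := closure K) fun x hx => hdiag x hx
      rw [closure_closure] at this
      convert this
      rw [← Matrix.fromBlocks_toBlocks v']
      congr 1
      ext i j; fin_cases i; fin_cases j; rfl
    have hc : Continuous fun a : Matrix (Fin 1 ⊕ Fin n) (Fin 1 ⊕ Fin n) R =>
        a.submatrix e.symm e.symm := by fun_prop
    have := map_mem_closure hc hcl (t := {a : Matrix (Fin (n + 1)) (Fin (n + 1)) R | IsUnit a})
      fun a ha => by
        exact (IsUnit.map (Matrix.reindexRingEquiv R e) (x := a) ha : _)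
    simpa [hv'] using this

/-- Stable rank one implies stable finiteness. -/
theorem IsStableRankOne.isStablyFiniteCStar {A : Type*} [CStarAlgebra A]
    (h : IsStableRankOne A) : IsStablyFiniteCStar A := by
  intro n v hv
  let _ : NormedRing (Matrix (Fin n) (Fin n) A) := Matrix.linftyOpNormedRing
  have : @CompleteSpace (Matrix (Fin n) (Fin n) A) PseudoMetricSpace.toUniformSpace :=
    inferInstanceAs (CompleteSpace (Fin n → Fin n → A))
  -- Units are open and `star v * v = 1`, so some invertible `b` near `v` makes `star v * b`
  -- invertible. Then `star v` is invertible, and so is `v`.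
  have hopen : ∀ᶠ b in 𝓝 v, IsUnit (star v * b) := by
    have hc : Continuous fun b : Matrix (Fin n) (Fin n) A => star v * b := by fun_prop
    have := hc.tendsto v
    rw [hv] at this
    exact this (Units.isOpen.mem_nhds isUnit_one)
  have hd := Matrix.dense_setOf_isUnit h n
  obtain ⟨b, hb1, hb2⟩ := mem_closure_iff_nhds.1 (hd v) _ hopen
  have hvs : IsUnit (star v) := by
    obtain ⟨w, hw⟩ := hb2
    have h1 : IsUnit (star v * b * ((w⁻¹ : _ˣ) : Matrix (Fin n) (Fin n) A)) :=
      hb1.mul w⁻¹.isUnit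
    rwa [mul_assoc, ← hw, Units.mul_inv, mul_one] at h1
  have := hvs.star
  rw [star_star] at this
  obtain ⟨w, hw⟩ := this
  rw [← hw] at hv ⊢
  rw [left_inv_eq_right_inv hv w.mul_inv, w.mul_inv]

/-! ### Real rank zero -/

/-- The polynomial `t * ∏ j ∈ [1, k], (t ^ 2 - (j / n) ^ 2)`. -/
noncomputable def gridPoly (n : ℕ) : ℕ → ℝ → ℝ
  | 0, t => t
  | k + 1, t => gridPoly n k t * (t * t) - (((k + 1 : ℕ) : ℝ) / n) ^ 2 * gridPoly n k t

theorem continuous_gridPoly (n k : ℕ) : Continuous (gridPoly n k) := by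
  induction k with
  | zero => exact continuous_id
  | succ k ih => simp only [gridPoly]; fun_prop

theorem gridPoly_eq_zero {n k : ℕ} (i : ℤ) (hi : i.natAbs ≤ k) :
    gridPoly n k ((i : ℝ) / n) = 0 := by
  induction k with
  | zero =>
    have : i = 0 := by omega
    simp [gridPoly, this]
  | succ k ih =>
    rw [gridPoly]
    rcases hi.lt_or_eq with h | h
    · simp [ih (by omega)]
    · have h2 : (((k + 1 : ℕ) : ℝ)) ^ 2 = (i : ℝ) ^ 2 := by
        rw [← h]
        rw [Nat.cast_natAbs, Int.cast_abs, sq_abs]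
      rw [div_pow, h2]
      ring

theorem exists_eq_div_of_gridPoly_eq_zero {n k : ℕ} {t : ℝ} (h : gridPoly n k t = 0) :
    ∃ i : ℤ, t = (i : ℝ) / n := by
  induction k with
  | zero => exact ⟨0, by simpa [gridPoly] using h⟩
  | succ k ih =>
    have h' : gridPoly n k t * ((t - ((k + 1 : ℕ) : ℝ) / n) * (t + ((k + 1 : ℕ) : ℝ) / n)) = 0 := by
      rw [← h, gridPoly]; ring
    rcases mul_eq_zero.1 h' with h | h
    · exact ih h
    · rcases mul_eq_zero.1 h with h | h
      · exact ⟨(k + 1 : ℕ), by push_cast at h ⊢; linarith⟩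
      · exact ⟨-(k + 1 : ℕ), by push_cast at h ⊢; rw [neg_div]; linarith⟩

/-- The `*`-polynomial `gridPoly n k` in a term. -/
noncomputable def CStarLogic.Term.grid {m : ℕ} (n : ℕ) (s : Term m) : ℕ → Term m
  | 0 => s
  | k + 1 => .sub (.mul (s.grid n k) (.mul s s))
      (.smul (((((k + 1 : ℕ) : ℝ) / n) ^ 2 : ℝ) : ℂ) (s.grid n k))

theorem CStarLogic.Term.eval_grid {A : Type*} [CStarAlgebra A] {m : ℕ} (n : ℕ) (s : Term m)
    (v : Fin m → A) (hs : IsSelfAdjoint (s.eval v)) (k : ℕ) :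
    (s.grid n k).eval v = cfc (gridPoly n k) (s.eval v) := by
  have hcont := fun k => (continuous_gridPoly n k).continuousOn (s := spectrum ℝ (s.eval v))
  induction k with
  | zero => exact (cfc_id' ℝ (s.eval v)).symm
  | succ k ih =>
    have h1 : cfc (fun t : ℝ => t * t) (s.eval v) = s.eval v * s.eval v := by
      rw [cfc_mul _ _ _, cfc_id' ℝ (s.eval v)]
    have h2 : (gridPoly n (k + 1)) = fun t => gridPoly n k t * (t * t) -
        (((k + 1 : ℕ) : ℝ) / n) ^ 2 * gridPoly n k t := rfl
    have := hcont k
    rw [h2, cfc_sub _ _ _ (by fun_prop) (by fun_prop), cfc_mul _ _ _, h1,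
      cfc_const_mul _ _ _, ← ih, Term.grid, Term.eval_sub]
    simp only [Term.eval]
    rw [Complex.coe_smul]

/-- Rounding to the nearest multiple of `1 / n`. -/
noncomputable def roundTo (n : ℕ) (t : ℝ) : ℝ := (⌊n * t + 1 / 2⌋ : ℝ) / n

theorem abs_sub_roundTo_le {n : ℕ} (hn : 0 < n) (t : ℝ) : |t - roundTo n t| ≤ 1 / n := by
  have hn' : (0 : ℝ) < n := by exact_mod_cast hn
  have h1 := Int.floor_le (n * t + 1 / 2)
  have h2 := Int.lt_floor_add_one (n * t + 1 / 2)
  have h3 : t - roundTo n t = (n * t - ⌊n * t + 1 / 2⌋) / n := by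
    rw [roundTo]; field_simp
  rw [h3, abs_div, abs_of_pos hn']
  gcongr
  rw [abs_le]
  constructor <;> linarith

theorem natAbs_floor_le {n : ℕ} {t : ℝ} (ht : |t| ≤ 1) :
    (⌊n * t + 1 / 2⌋ : ℤ).natAbs ≤ n := by
  obtain ⟨h1, h2⟩ := abs_le.1 ht
  have hn' : (0 : ℝ) ≤ n := by positivity
  have h3 : ⌊n * t + 1 / 2⌋ < (n : ℤ) + 1 := by
    rw [Int.floor_lt]; push_cast; nlinarith
  have h4 : -(n : ℤ) ≤ ⌊n * t + 1 / 2⌋ := by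
    rw [Int.le_floor]; push_cast; nlinarith
  omega

theorem continuousAt_roundTo {n : ℕ} {t : ℝ} (ht : ∀ i : ℤ, n * t + 1 / 2 ≠ i) :
    ContinuousAt (roundTo n) t := by
  have h1 : (⌊n * t + 1 / 2⌋ : ℝ) < n * t + 1 / 2 :=
    lt_of_le_of_ne (Int.floor_le _) (ht _).symm
  have h2 := Int.lt_floor_add_one (n * t + 1 / 2)
  have hc : Continuous fun s : ℝ => n * s + 1 / 2 := by fun_prop
  have : roundTo n =ᶠ[𝓝 t] fun _ => (⌊n * t + 1 / 2⌋ : ℝ) / n := by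
    filter_upwards [hc.continuousAt.eventually_mem (Ioo_mem_nhds h1 h2)] with s hs
    rw [roundTo, Int.floor_eq_iff.2 ⟨hs.1.le, hs.2⟩]
  exact continuousAt_const.congr this.symm

theorem abs_le_norm_of_mem_spectrum {A : Type*} [CStarAlgebra A] {s : A} {t : ℝ}
    (ht : t ∈ spectrum ℝ s) : |t| ≤ ‖s‖ := by
  have := spectrum.norm_le_norm_mul_of_mem ht
  have h1 := CStarAlgebra.norm_one_le A
  rw [Real.norm_eq_abs] at this
  nlinarith [norm_nonneg s]

theorem norm_re_le {A : Type*} [CStarAlgebra A] {y : A} (hy : ‖y‖ ≤ 1) :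
    ‖(1 / 2 : ℂ) • (y + star y)‖ ≤ 1 := by
  rw [norm_smul]
  have := norm_add_le y (star y)
  rw [norm_star] at this
  norm_num
  linarith

theorem isSelfAdjoint_re {A : Type*} [CStarAlgebra A] (y : A) :
    IsSelfAdjoint ((1 / 2 : ℂ) • (y + star y)) := by
  refine IsSelfAdjoint.smul ?_ (IsSelfAdjoint.add_star_self y)
  rw [isSelfAdjoint_iff]
  simp

theorem re_eq_self {A : Type*} [CStarAlgebra A] {a : A} (ha : IsSelfAdjoint a) :
    (1 / 2 : ℂ) • (a + star a) = a := by
  rw [ha.star_eq, ← two_smul ℂ a, smul_smul]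
  norm_num

/-- In finite dimension rounding moves a self-adjoint contraction by at most `1 / n` and lands on
zeros of `gridPoly n n`. Quantifiers range over the whole ball, so self-adjoint parts stand in for
self-adjoint variables. -/
theorem IsPseudocompactCStar.exists_approx_grid {A : Type*} [CStarAlgebra A]
    (hA : IsPseudocompactCStar A) {a : A} (ha : ‖a‖ ≤ 1) (has : IsSelfAdjoint a) {n : ℕ}
    (hn : 0 < n) {ε : ℝ} (hε : 0 < ε) :
    ∃ s : A, IsSelfAdjoint s ∧ ‖s‖ ≤ 1 ∧ ‖a - s‖ ≤ 1 / n + ε ∧ ‖cfc (gridPoly n n) s‖ ≤ ε := by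
  set a' : Term 2 := (Term.last 0).weaken.re with ha'
  set y' : Term 2 := (Term.last 1).re with hy'
  set φ : Formula 2 := .max (.affine 1 (-(1 / n)) (.norm (a'.sub y'))) (.norm (y'.grid n n)) with hφ
  have hval : ∀ {B : Type _} [CStarAlgebra B] (a y : B) (r : ℝ),
      (φ.eval (Fin.snoc (Fin.snoc Fin.elim0 a : Fin 1 → B) y : Fin 2 → B) ≤ r ↔
        ‖(1 / 2 : ℂ) • (a + star a) - (1 / 2 : ℂ) • (y + star y)‖ ≤ 1 / n + r ∧
        ‖cfc (gridPoly n n) ((1 / 2 : ℂ) • (y + star y))‖ ≤ r) := by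
    intro B _ a y r
    have hy : y'.eval (Fin.snoc (Fin.snoc Fin.elim0 a : Fin 1 → B) y : Fin 2 → B) =
        (1 / 2 : ℂ) • (y + star y) := by
      rw [hy', Term.eval_re, Term.eval_last]
    have ha : a'.eval (Fin.snoc (Fin.snoc Fin.elim0 a : Fin 1 → B) y : Fin 2 → B) =
        (1 / 2 : ℂ) • (a + star a) := by
      rw [ha', Term.eval_re, Term.eval_weaken, Term.eval_last]
    rw [hφ, Formula.eval_max, Formula.eval_affine, max_le_iff]
    simp only [Formula.eval]
    rw [Term.eval_sub, Term.eval_grid _ _ _ (hy ▸ isSelfAdjoint_re y), hy, ha]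
    refine and_congr_left' ?_
    constructor <;> intro h <;> linarith
  have h : Sentence.val (.sup (.inf φ)) A ≤ 0 := by
    refine hA.val_le_of_unital fun F _ _ _ => ?_
    rw [Sentence.val, Formula.eval_sup_le_iff inBall_elim0]
    intro a ha
    rw [Formula.eval_inf_le_iff (inBall_elim0.snoc ha)]
    intro ε hε
    set s : F := (1 / 2 : ℂ) • (a + star a) with hs
    have hss : IsSelfAdjoint s := isSelfAdjoint_re a
    have hs1 : ‖s‖ ≤ 1 := norm_re_le ha
    have hfin : (spectrum ℝ s).Finite := by
      refine ((spectrum.finite_of_finiteDimensional s).preimage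
        (FaithfulSMul.algebraMap_injective ℝ ℂ).injOn).subset fun t ht => ?_
      exact (spectrum.algebraMap_mem_iff ℂ).2 ht
    -- Every function is continuous on a finite spectrum, so the discontinuous rounding is
    -- admissible here.
    have hcont : ContinuousOn (roundTo n) (spectrum ℝ s) := hfin.continuousOn _
    have hsp : ∀ t ∈ spectrum ℝ s, |t| ≤ 1 := fun t ht =>
      (abs_le_norm_of_mem_spectrum ht).trans hs1
    -- The clamp makes the norm bound immediate and changes nothing on the spectrum, since rounding
    -- preserves [-1, 1].
    refine ⟨cfc (fun t => max (-1) (min 1 (roundTo n t))) s, ?_, ?_⟩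
    · refine norm_cfc_le zero_le_one fun t _ => ?_
      rw [Real.norm_eq_abs, abs_le]
      exact ⟨le_max_left _ _, max_le (by norm_num) (min_le_left _ _)⟩
    have heq : cfc (fun t => max (-1) (min 1 (roundTo n t))) s = cfc (roundTo n) s := by
      refine cfc_congr fun t ht => ?_
      have h1 : |roundTo n t| ≤ 1 := by
        have hn' : (0 : ℝ) < n := by exact_mod_cast hn
        rw [roundTo, abs_div, abs_of_pos hn', div_le_one hn']
        have := natAbs_floor_le (n := n) (hsp t ht)
        rw [← Int.cast_abs, Int.abs_eq_natAbs]
        exact_mod_cast this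
      rw [abs_le] at h1
      simp [h1]
    rw [heq, hval, re_eq_self (cfc_predicate (roundTo n) s), zero_add]
    constructor
    · have : s - cfc (roundTo n) s = cfc (fun t => t - roundTo n t) s := by
        rw [cfc_sub _ _ _, cfc_id' ℝ s]
      rw [← hs, this]
      have h0 : ‖cfc (fun t => t - roundTo n t) s‖ ≤ 1 / n :=
        norm_cfc_le (by positivity) fun t _ => abs_sub_roundTo_le hn t
      linarith
    · have hc := (continuous_gridPoly n n).continuousOn (s := roundTo n '' spectrum ℝ s)
      rw [← cfc_comp (gridPoly n n) (roundTo n) s]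
      have : cfc (gridPoly n n ∘ roundTo n) s = cfc (fun _ : ℝ => (0 : ℝ)) s :=
        cfc_congr fun t ht => gridPoly_eq_zero _ (natAbs_floor_le (hsp t ht))
      rw [this, cfc_const_zero, norm_zero]
      exact hε.le
  rw [Sentence.val, Formula.eval_sup_le_iff inBall_elim0] at h
  have h := h a ha
  rw [Formula.eval_inf_le_iff (inBall_elim0.snoc ha)] at h
  obtain ⟨y, hy, h⟩ := h ε hε
  rw [hval, re_eq_self has, zero_add] at h
  exact ⟨_, isSelfAdjoint_re y, norm_re_le hy, h.1, h.2⟩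

/-- Rounding can jump only halfway between grid points. None of these points is a zero of the
polynomial, and only finitely many lie in [-1, 1]. -/
theorem exists_pos_le_abs_gridPoly {n : ℕ} (hn : 0 < n) :
    ∃ δ > 0, ∀ t : ℝ, |t| ≤ 1 → (∃ i : ℤ, n * t + 1 / 2 = i) → δ ≤ |gridPoly n n t| := by
  have hn' : (0 : ℝ) < n := by exact_mod_cast hn
  set S : Finset ℤ := Finset.Icc (-(n : ℤ)) (n + 1)
  obtain ⟨j, -, hj⟩ := S.exists_min_image (fun i => |gridPoly n n (((i : ℝ) - 1 / 2) / n)|)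
    ⟨0, by simp [S]; omega⟩
  refine ⟨|gridPoly n n (((j : ℝ) - 1 / 2) / n)|, abs_pos.2 fun h => ?_, fun t ht ⟨i, hi⟩ => ?_⟩
  · obtain ⟨i, hi⟩ := exists_eq_div_of_gridPoly_eq_zero h
    rw [div_left_inj' hn'.ne'] at hi
    have : (2 * j - 1 : ℤ) = 2 * i := by
      rify; linarith
    omega
  · have hti : t = ((i : ℝ) - 1 / 2) / n := by
      rw [← hi]; field_simp; ring
    rw [hti]
    refine hj i (Finset.mem_Icc.2 ?_)
    have := natAbs_floor_le (n := n) ht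
    rw [hi, Int.floor_intCast] at this
    omega

open scoped Pointwise in
theorem IsPseudocompactCStar.isRealRankZero {A : Type*} [CStarAlgebra A]
    (hA : IsPseudocompactCStar A) : IsRealRankZero A := by
  have key : ∀ a : A, ‖a‖ ≤ 1 → IsSelfAdjoint a →
      a ∈ closure {b : A | IsSelfAdjoint b ∧ (spectrum ℂ b).Finite} := by
    intro a ha has
    rw [Metric.mem_closure_iff]
    intro ε hε
    obtain ⟨n, hn⟩ := exists_nat_one_div_lt (show 0 < ε / 3 by positivity)
    obtain ⟨δ, hδ, hgap⟩ := exists_pos_le_abs_gridPoly n.succ_pos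
    obtain ⟨s, hss, hs1, has', hgs⟩ := hA.exists_approx_grid ha has n.succ_pos
      (show 0 < min (δ / 2) (ε / 3) by positivity)
    set N := n + 1
    have hsp : ∀ t ∈ spectrum ℝ s, |t| ≤ 1 := fun t ht =>
      (abs_le_norm_of_mem_spectrum ht).trans hs1
    -- On the spectrum the polynomial is at most `δ / 2` in absolute value, while at a jump it is at
    -- least `δ`; the spectrum therefore avoids the jumps.
    have hcont : ContinuousOn (roundTo N) (spectrum ℝ s) := fun t ht => by
      refine (continuousAt_roundTo fun i hi => ?_).continuousWithinAt
      have h1 := hgap t (hsp t ht) ⟨i, hi⟩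
      have h2 := norm_apply_le_norm_cfc (gridPoly N N) s ht
        (continuous_gridPoly N N).continuousOn
      rw [Real.norm_eq_abs] at h2
      linarith [hgs.trans (min_le_left _ _)]
    refine ⟨cfc (roundTo N) s, ⟨cfc_predicate (roundTo N) s, ?_⟩, ?_⟩
    · have hsa : IsSelfAdjoint (cfc (roundTo N) s) := cfc_predicate (roundTo N) s
      rw [← hsa.spectrumRestricts.algebraMap_image, cfc_map_spectrum (roundTo N) s]
      refine Set.Finite.image _ ?_
      refine ((Finset.Icc (-(N : ℤ)) N).finite_toSet.image fun i : ℤ => (i : ℝ) / N).subset ?_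
      rintro _ ⟨t, ht, rfl⟩
      have := natAbs_floor_le (n := N) (hsp t ht)
      exact ⟨⌊N * t + 1 / 2⌋, by simp only [Finset.coe_Icc, Set.mem_Icc]; omega, rfl⟩
    · have h1 : s - cfc (roundTo N) s = cfc (fun t => t - roundTo N t) s := by
        rw [cfc_sub _ _ _, cfc_id' ℝ s]
      have h2 : ‖s - cfc (roundTo N) s‖ ≤ 1 / N := by
        rw [h1]
        exact norm_cfc_le (by positivity) fun t _ => abs_sub_roundTo_le n.succ_pos t
      have hN : (1 : ℝ) / N < ε / 3 := by simpa [N] using hn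
      rw [dist_eq_norm]
      calc _ ≤ ‖a - s‖ + ‖s - cfc (roundTo N) s‖ := norm_sub_le_norm_sub_add_norm_sub _ _ _
        _ < ε := by linarith [min_le_right (δ / 2) (ε / 3)]
  intro a has
  have hc : (‖a‖ + 1 : ℝ) ≠ 0 := by positivity
  have hn : ‖(‖a‖ + 1 : ℝ)⁻¹ • a‖ ≤ 1 := by
    rw [norm_smul, norm_inv, Real.norm_of_nonneg (by positivity), inv_mul_le_one₀ (by positivity)]
    linarith
  have := map_mem_closure (continuous_const_smul (‖a‖ + 1 : ℝ))
    (key _ hn ((IsSelfAdjoint.all _).smul has))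
    (t := {b : A | IsSelfAdjoint b ∧ (spectrum ℂ b).Finite}) fun b hb => by
      refine ⟨(IsSelfAdjoint.all _).smul hb.1, ?_⟩
      rw [← Complex.coe_smul]
      have hc' : ((‖a‖ + 1 : ℝ) : ℂ) ≠ 0 := by exact_mod_cast hc
      have := spectrum.unit_smul_eq_smul b (Units.mk0 _ hc')
      rw [Units.smul_mk0, Units.smul_mk0] at this
      rw [this]
      exact hb.2.image _
  rwa [smul_inv_smul₀ hc] at this

/-! ### Tracial states -/

/-- The normalized trace of the regular representation is a contractive tracial functional. -/
theorem exists_tracial_of_finiteDimensional (F : Type*) [CStarAlgebra F] [FiniteDimensional ℂ F]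
    [Nontrivial F] :
    ∃ τ : F →ₗ[ℂ] ℂ, τ 1 = 1 ∧ (∀ a b, τ (a * b) = τ (b * a)) ∧ ∀ a, ‖τ a‖ ≤ ‖a‖ := by
  set d : ℂ := (Module.finrank ℂ F : ℂ) with hd
  have hd0 : d ≠ 0 := by
    rw [hd]; exact_mod_cast (Module.finrank_pos (R := ℂ) (M := F)).ne'
  have htr : ∀ a : F, ‖LinearMap.trace ℂ F (Algebra.lmul ℂ F a)‖ ≤ Module.finrank ℂ F * ‖a‖ := by
    intro a
    -- The trace is a sum of at most `finrank` eigenvalues of left multiplication, each in the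
    -- spectrum of `a` and so of modulus at most `‖a‖`.
    rw [Module.End.trace_eq_sum_roots_charpoly_of_splits (IsAlgClosed.splits _)]
    refine (norm_multiset_sum_le _).trans ?_
    refine (Multiset.sum_le_card_nsmul _ ‖a‖ fun r hr => ?_).trans ?_
    · obtain ⟨z, hz, rfl⟩ := Multiset.mem_map.1 hr
      have h1 : z ∈ spectrum ℂ (Algebra.lmul ℂ F a) :=
        (Module.End.mem_spectrum_iff_isRoot_charpoly _ _).2 (Polynomial.isRoot_of_mem_roots hz)
      exact spectrum.norm_le_norm_of_mem (AlgHom.spectrum_apply_subset (Algebra.lmul ℂ F) a h1)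
    · rw [nsmul_eq_mul, Multiset.card_map]
      gcongr
      exact (Polynomial.card_roots' _).trans (LinearMap.charpoly_natDegree _).le
  refine ⟨d⁻¹ • (LinearMap.trace ℂ F ∘ₗ (Algebra.lmul ℂ F).toLinearMap), ?_, ?_, ?_⟩
  · simp only [LinearMap.smul_apply, LinearMap.comp_apply, AlgHom.toLinearMap_apply, map_one,
      LinearMap.trace_one, smul_eq_mul]
    exact inv_mul_cancel₀ hd0
  · intro a b
    simp only [LinearMap.smul_apply, LinearMap.comp_apply, AlgHom.toLinearMap_apply, map_mul]
    rw [LinearMap.trace_mul_comm]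
  · intro a
    simp only [LinearMap.smul_apply, LinearMap.comp_apply, AlgHom.toLinearMap_apply, norm_smul,
      norm_inv]
    have : ‖d‖ = Module.finrank ℂ F := by simp [d]
    rw [this, inv_mul_le_iff₀ (by rw [← this]; exact norm_pos_iff.2 hd0)]
    exact htr a

/-- The sum of a finite family of terms. -/
def CStarLogic.Term.sum {m : ℕ} : (k : ℕ) → (Fin k → Term m) → Term m
  | 0, _ => .zero
  | k + 1, f => .add (Term.sum k fun i => f i.castSucc) (f (Fin.last k))

theorem CStarLogic.Term.eval_sum {A : Type*} [NonUnitalCStarAlgebra A] {m k : ℕ}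
    (f : Fin k → Term m) (v : Fin m → A) : (Term.sum k f).eval v = ∑ i, (f i).eval v := by
  induction k with
  | zero => simp [Term.sum, Term.eval]
  | succ k ih => simp [Term.sum, Term.eval, ih, Fin.sum_univ_castSucc]

/-- Sums of commutators stay at distance one from the identity. -/
theorem IsPseudocompactCStar.one_le_norm_one_sub_sum {A : Type*} [CStarAlgebra A]
    (hA : IsPseudocompactCStar A) {k : ℕ} (x y : Fin k → A) (hx : ∀ i, ‖x i‖ ≤ 1)
    (hy : ∀ i, ‖y i‖ ≤ 1) (r : ℂ) : 1 ≤ ‖1 - r • ∑ i, (x i * y i - y i * x i)‖ := by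
  let X : Fin k → Term (0 + 1 + (k + k)) := fun i => .var (Fin.natAdd (0 + 1) (Fin.castAdd k i))
  let Y : Fin k → Term (0 + 1 + (k + k)) := fun i => .var (Fin.natAdd (0 + 1) (Fin.natAdd k i))
  let E : Term (0 + 1 + (k + k)) := .var (Fin.castAdd (k + k) (Fin.last 0))
  -- The variable `E` plays the identity. The lower bound 1 on the norm is turned into an upper
  -- bound 0 on `1 - ‖·‖`.
  let φ : Formula (0 + 1 + (k + k)) := .affine (-1) 1 (.norm (E.sub (.smul r
    (.sum k fun i => ((X i).mul (Y i)).sub ((Y i).mul (X i))))))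
  have hval : ∀ {B : Type _} [CStarAlgebra B] (e : B) (w : Fin (k + k) → B),
      φ.eval (Fin.append (Fin.snoc Fin.elim0 e : Fin (0 + 1) → B) w) =
        1 - ‖e - r • ∑ i, (w (Fin.castAdd k i) * w (Fin.natAdd k i) -
          w (Fin.natAdd k i) * w (Fin.castAdd k i))‖ := by
    intro B _ e w
    simp only [φ, Formula.eval_affine, Formula.eval, Term.eval_sub]
    simp only [Term.eval, Term.eval_sum, X, Y, E, Fin.append_left, Fin.append_right,
      Fin.snoc_last, neg_one_smul, ← sub_eq_add_neg]
    ring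
  have h : Sentence.val (.inf (.max (.identityDefect (Term.last 0)) (.supLast (k + k) φ))) A ≤ 0 := by
    refine hA.val_le_of_unital fun F _ _ _ => ?_
    rw [Sentence.val, Formula.eval_inf_le_iff inBall_elim0]
    intro ε hε
    have hb := inBall_elim0.snoc (CStarAlgebra.norm_one_le F)
    refine ⟨1, CStarAlgebra.norm_one_le F, ?_⟩
    rw [Formula.eval_max, max_le_iff, Formula.eval_identityDefect_le_iff hb,
      Formula.eval_supLast_le_iff hb]
    refine ⟨fun x _ => by simpa using hε.le, fun w _ => ?_⟩
    rw [hval]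
    obtain ⟨τ, h1, hc, hτ⟩ := exists_tracial_of_finiteDimensional F
    have := hτ (1 - r • ∑ i, (w (Fin.castAdd k i) * w (Fin.natAdd k i) -
          w (Fin.natAdd k i) * w (Fin.castAdd k i)))
    have h0 : τ (1 - r • ∑ i, (w (Fin.castAdd k i) * w (Fin.natAdd k i) -
          w (Fin.natAdd k i) * w (Fin.castAdd k i))) = 1 := by
      rw [map_sub, map_smul, map_sum, h1, Finset.sum_eq_zero, smul_zero, sub_zero]
      intro i _
      rw [map_sub, hc, sub_self]
    rw [h0, norm_one] at this
    linarith
  rw [Sentence.val, Formula.eval_inf_le_iff inBall_elim0] at h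
  refine le_of_forall_pos_le_add fun ε hε => ?_
  obtain ⟨e, he, h⟩ := h (ε / 2) (half_pos hε)
  have hb := inBall_elim0.snoc he
  rw [Formula.eval_max, max_le_iff, Formula.eval_identityDefect_le_iff hb,
    Formula.eval_supLast_le_iff hb] at h
  obtain ⟨h1, h2⟩ := h
  have h1 := (h1 1 (CStarAlgebra.norm_one_le A)).1
  rw [Term.eval_last, mul_one, zero_add] at h1
  have h2 := h2 (Fin.append x y) (by
    intro i
    refine Fin.addCases (fun i => ?_) (fun i => ?_) i
    · rw [Fin.append_left]; exact hx i
    · rw [Fin.append_right]; exact hy i)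
  rw [hval] at h2
  simp only [Fin.append_left, Fin.append_right] at h2
  -- Replacing `e` by 1 costs `ε / 2`, and the approximate infimum costs the other `ε / 2`.
  have h3 := norm_sub_le_norm_sub_add_norm_sub e 1 (r • ∑ i, (x i * y i - y i * x i))
  linarith

/-- The linear span of the commutators. -/
noncomputable def commutatorSpan (A : Type*) [CStarAlgebra A] : Submodule ℂ A :=
  Submodule.span ℂ {z | ∃ x y : A, z = x * y - y * x}

/-- Removes the norm restriction: all factors are divided by a common bound `M`, and the scalar `M *
M` undoes this. -/
theorem IsPseudocompactCStar.one_le_norm_one_sub {A : Type*} [CStarAlgebra A]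
    (hA : IsPseudocompactCStar A) {z : A} (hz : z ∈ commutatorSpan A) : 1 ≤ ‖1 - z‖ := by
  obtain ⟨k, c, g, rfl⟩ := Submodule.mem_span_set'.1 hz
  choose x y hxy using fun i => (g i).2
  set M : ℝ := 1 + ∑ i, ‖c i • x i‖ + ∑ i, ‖y i‖ with hM
  have hs1 : 0 ≤ ∑ i, ‖c i • x i‖ := Finset.sum_nonneg fun _ _ => norm_nonneg _
  have hs2 : 0 ≤ ∑ i, ‖y i‖ := Finset.sum_nonneg fun _ _ => norm_nonneg _
  have hM0 : 0 < M := by positivity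
  have hM0' : (M : ℂ) ≠ 0 := by exact_mod_cast hM0.ne'
  have hscale : ∀ a : A, ‖a‖ ≤ M → ‖(M : ℂ)⁻¹ • a‖ ≤ 1 := fun a ha => by
    rwa [norm_smul, norm_inv, Complex.norm_real, Real.norm_of_nonneg hM0.le, inv_mul_le_one₀ hM0]
  have := hA.one_le_norm_one_sub_sum (fun i => (M : ℂ)⁻¹ • c i • x i) (fun i => (M : ℂ)⁻¹ • y i)
    (fun i => hscale _ ?_) (fun i => hscale _ ?_) (M * M)
  · convert this using 3
    rw [Finset.smul_sum]
    refine Finset.sum_congr rfl fun i _ => ?_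
    simp only [hxy, smul_mul_assoc, mul_smul_comm, smul_sub, smul_smul]
    congr 2 <;> field_simp
  · have := Finset.single_le_sum (f := fun i => ‖c i • x i‖) (fun _ _ => norm_nonneg _)
      (Finset.mem_univ i)
    linarith
  · have := Finset.single_le_sum (f := fun i => ‖y i‖) (fun _ _ => norm_nonneg _)
      (Finset.mem_univ i)
    linarith

/-- A contractive unital functional takes real values on self-adjoint elements. -/
theorem im_eq_zero_of_contractive {A : Type*} [CStarAlgebra A] {f : A →ₗ[ℂ] ℂ} (h1 : f 1 = 1)
    (hf : ∀ a, ‖f a‖ ≤ ‖a‖) {a : A} (ha : IsSelfAdjoint a) : (f a).im = 0 := by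
  have key : ∀ t : ℝ, (f a).re ^ 2 + ((f a).im + t) ^ 2 ≤ ‖a‖ ^ 2 + t ^ 2 := by
    intro t
    have h2 := hf (a + (t * Complex.I) • 1)
    have h3 : ‖f (a + (t * Complex.I) • 1)‖ ^ 2 = (f a).re ^ 2 + ((f a).im + t) ^ 2 := by
      rw [map_add, map_smul, h1, Complex.sq_norm, Complex.normSq_apply]
      simp
      ring
    have h4 : ‖a + (t * Complex.I) • (1 : A)‖ ^ 2 ≤ ‖a‖ ^ 2 + t ^ 2 := by
      have h5 : star (a + (t * Complex.I) • (1 : A)) * (a + (t * Complex.I) • 1) =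
          a * a + ((t ^ 2 : ℝ) : ℂ) • 1 := by
        simp only [star_add, ha.star_eq, star_smul, star_one, mul_add, add_mul, smul_mul_assoc,
          mul_smul_comm, one_mul, mul_one, smul_add, smul_smul]
        have e1 : (star ((t : ℂ) * Complex.I)) = -(t * Complex.I) := by simp
        have e2 : (t * Complex.I) * star ((t : ℂ) * Complex.I) = ((t ^ 2 : ℝ) : ℂ) := by
          rw [e1]; push_cast; linear_combination (-(t : ℂ) ^ 2) * Complex.I_sq
        rw [e2, e1]
        module
      rw [sq, ← CStarRing.norm_star_mul_self, h5]
      refine (norm_add_le _ _).trans (add_le_add ((norm_mul_le _ _).trans (sq _).ge) ?_)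
      rw [norm_smul, Complex.norm_real, Real.norm_of_nonneg (sq_nonneg t)]
      exact mul_le_of_le_one_right (sq_nonneg t) (CStarAlgebra.norm_one_le A)
    rw [← h3]
    exact (pow_le_pow_left₀ (norm_nonneg _) h2 2).trans h4
  by_contra h
  -- `key` forces `2 * (f a).im * t ≤ ‖a‖ ^ 2` for every real `t`; this `t` makes the left side `‖a‖
  -- ^ 2 + 1`.
  have := key ((‖a‖ ^ 2 + 1) / (2 * (f a).im))
  have h6 : 2 * (f a).im * ((‖a‖ ^ 2 + 1) / (2 * (f a).im)) = ‖a‖ ^ 2 + 1 := by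
    field_simp
  nlinarith [sq_nonneg (f a).re, sq_nonneg (f a).im]

open scoped ComplexOrder in
/-- A contractive unital functional is positive. -/
theorem nonneg_of_contractive {A : Type*} [CStarAlgebra A] {f : A →ₗ[ℂ] ℂ} (h1 : f 1 = 1)
    (hf : ∀ a, ‖f a‖ ≤ ‖a‖) (a : A) : 0 ≤ f (star a * a) := by
  set c := star a * a with hc
  have hcs : IsSelfAdjoint c := .star_mul_self a
  have him := im_eq_zero_of_contractive h1 hf hcs
  -- The spectrum of `c` lies in `[0, ‖c‖]`. Contractivity then gives `‖c‖ - Re (f c) ≤ ‖c‖`.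
  have h2 : ‖((‖c‖ : ℝ) : ℂ) • (1 : A) - c‖ ≤ ‖c‖ := by
    have h3 : ((‖c‖ : ℝ) : ℂ) • (1 : A) - c = cfc (fun t : ℝ => ‖c‖ - t) c := by
      rw [cfc_sub _ _ _, cfc_id' ℝ c, cfc_const _ _ hcs, Complex.coe_smul,
        Algebra.algebraMap_eq_smul_one]
    rw [h3]
    refine norm_cfc_le (norm_nonneg _) fun t ht => ?_
    have h4 := spectrum_star_mul_self_nonneg t ht
    have h5 := (abs_le.1 (abs_le_norm_of_mem_spectrum ht)).2
    rw [Real.norm_eq_abs, abs_le]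
    constructor <;> linarith
  have h3 := (hf _).trans h2
  rw [map_sub, map_smul, h1, smul_eq_mul, mul_one] at h3
  have h4 := (Complex.re_le_norm _).trans h3
  rw [Complex.sub_re, Complex.ofReal_re] at h4
  rw [Complex.nonneg_iff]
  exact ⟨by linarith, him.symm⟩

/-- The class of 1 modulo commutators has norm 1, so Hahn-Banach supplies a norming functional on
the quotient. The span need not be closed; the quotient seminorm suffices because it does not vanish
on that class. -/
theorem IsPseudocompactCStar.nonempty_tracialState {A : Type*} [CStarAlgebra A]
    (hA : IsPseudocompactCStar A) : Nonempty (TracialState A) := by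
  set q := (commutatorSpan A).mkQ
  have hq1 : ∀ a, ‖q a‖ ≤ ‖a‖ := fun a => Submodule.Quotient.norm_mk_le _ a
  have hq : ‖q 1‖ = 1 := by
    refine le_antisymm ((hq1 1).trans (CStarAlgebra.norm_one_le A)) ?_
    refine QuotientAddGroup.le_norm_iff.2 fun m hm => ?_
    have : 1 - m ∈ commutatorSpan A := (Submodule.Quotient.eq _).1 hm.symm
    simpa using hA.one_le_norm_one_sub this
  obtain ⟨g, hg, hg1⟩ := exists_dual_vector ℂ (q 1) (by rw [hq]; exact one_ne_zero)
  set f : A →ₗ[ℂ] ℂ := g.toLinearMap ∘ₗ q with hf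
  have hf1 : f 1 = 1 := by
    change g (q 1) = 1
    rw [hg1, hq]; simp
  have hfc : ∀ a, ‖f a‖ ≤ ‖a‖ := fun a => by
    have := g.le_opNorm (q a)
    rw [hg, one_mul] at this
    exact this.trans (hq1 a)
  refine ⟨⟨f, nonneg_of_contractive hf1 hfc, hf1, fun a b => ?_⟩⟩
  rw [← sub_eq_zero, ← map_sub]
  have : q (a * b - b * a) = 0 :=
    (Submodule.Quotient.mk_eq_zero _).2 (Submodule.subset_span ⟨a, b, rfl⟩)
  simp [hf, this]

/-- Pseudocompact C*-algebras are unital, and, as unital C*-algebras, they have real rank zero and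
stable rank one, are stably finite, and have a tracial state. -/
theorem proposition4p3 (A : Type*) [NonUnitalCStarAlgebra A] (hA : IsPseudocompactCStar A) :
    ∃ h : HasIdentity A,
      letI : CStarAlgebra A := h.cstarAlgebra
      IsRealRankZero A ∧ IsStableRankOne A ∧ IsStablyFiniteCStar A ∧ Nonempty (TracialState A) := by
  refine ⟨hA.hasIdentity, ?_⟩
  let _ : CStarAlgebra A := hA.hasIdentity.cstarAlgebra
  -- The unital structure induces the given non-unital one definitionally, so pseudocompactness
  -- carries over unchanged.
  have hA' : IsPseudocompactCStar A := hA
  exact ⟨hA'.isRealRankZero, hA'.isStableRankOne, hA'.isStableRankOne.isStablyFiniteCStar,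
    hA'.nonempty_tracialState⟩
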